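/- Let $H=\{(t,v)\in\mathbb R\times\mathbb R^3 : t^2-|v|^2=1,\ t>0\}$ be hyperbolic 3-space, with hyperbolic distance $d$ given by $\cosh d((t,v),(s,w))=ts-v\cdot w$ and hyperbolic volume $dx$ (which is $d^3v/\sqrt{1+|v|^2}$ in the coordinate $v$). For $\rho\ge 0$ let $$K_\rho(x,y)=\frac{\sin(\rho\, d(x,y))}{\rho\,\sinh d(x,y)},$$ extended by continuity to $d(x,y)=0$ and to $\rho=0$. For labels $\rho_{ij}=\rho_{ji}\ge 0$ $(1\le i<j\le 5)$ on the ten edges of the complete graph on the vertices $1,\dots,5$, and a point $x_5\in H$, the 4-simplex amplitude is $$I_{10}=\frac1{2\pi^2}\int_{H^4}\prod_{1\le i<j\le 5}K_{\rho_{ij}}(x_i,x_j)\,dx_1\,dx_2\,dx_3\,dx_4 .$$ Then this integral converges absolutely, and there are constants $K,K_1,K_2$, independent of the labels and of $x_5$, such that for all such labels and all $x_5\in H$: 1. $|I_{10}|\le \dfrac{K}{\rho_{ij}\,\rho_{ik}\,\rho_{jk}}$ for all distinct vertices $i,j,k$ for which the three labels $\rho_{ij},\rho_{ik},\rho_{jk}$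 of the triangle $ijk$ are positive; 2. $|I_{10}|\le \dfrac{K_1}{\rho_{ij}\,\rho_{ik}}$ for all distinct vertices $i,j,k$ for which $\rho_{ij},\rho_{ik}$ are positive (that is, for any two positive labels in a common triangle); 3. $|I_{10}|\le \dfrac{K_2}{\rho_{ij}}$ for all $i\ne j$ with $\rho_{ij}>0$. -/

import Mathlib

open MeasureTheory

noncomputable section

/-- The Minkowski product of signature `(+,-,-,-)` on `ℝ × ℝ³`. -/
def minkowski (x y : ℝ × EuclideanSpace ℝ (Fin 3)) : ℝ :=
  x.1 * y.1 - inner ℝ x.2 y.2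

/-- Hyperbolic 3-space: the upper sheet of the two-sheeted unit hyperboloid in Minkowski space. -/
abbrev Hyp : Type :=
  {x : ℝ × EuclideanSpace ℝ (Fin 3) // minkowski x x = 1 ∧ 0 < x.1}

/-- The hyperbolic distance, `cosh d(x,y) = x · y` for the Minkowski product. -/
def hypDist (x y : Hyp) : ℝ := Real.arcosh (minkowski x.1 y.1)

/-- The point of the upper sheet with spatial part `v`. -/
def hypPoint (v : EuclideanSpace ℝ (Fin 3)) : Hyp :=
  ⟨(√(1 + ‖v‖ ^ 2), v), by
    have h : (0 : ℝ) < 1 + ‖v‖ ^ 2 := by positivity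
    refine ⟨?_, Real.sqrt_pos.2 h⟩
    simp only [minkowski, real_inner_self_eq_norm_sq]
    rw [Real.mul_self_sqrt h.le]
    ring⟩

/-- The upper sheet is the graph of `v ↦ √(1 + |v|²)` over `ℝ³`, measurably. -/
def hypEquiv : EuclideanSpace ℝ (Fin 3) ≃ᵐ Hyp where
  toFun := hypPoint
  invFun x := x.1.2
  left_inv _ := rfl
  right_inv x := by
    obtain ⟨⟨t, v⟩, h1, h2⟩ := x
    simp only [minkowski, real_inner_self_eq_norm_sq] at h1 h2
    apply Subtype.ext
    refine Prod.ext ?_ rfl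
    change √(1 + ‖v‖ ^ 2) = t
    rw [show 1 + ‖v‖ ^ 2 = t ^ 2 by linarith, Real.sqrt_sq h2.le]
  measurable_toFun := by
    refine Measurable.subtype_mk ?_
    fun_prop
  measurable_invFun := measurable_snd.comp measurable_subtype_coe

/-- The hyperbolic (Riemannian, Lorentz-invariant) volume on the upper sheet. In the coordinate
`v ∈ ℝ³` it is `d³v / √(1 + |v|²)`; in polar coordinates, `sinh² r dr dΩ`. -/
def hypVol : Measure Hyp :=
  (volume.withDensity fun v : EuclideanSpace ℝ (Fin 3) =>
    ENNReal.ofReal (1 / √(1 + ‖v‖ ^ 2))).map hypEquiv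

instance hypVol_sigmaFinite : SigmaFinite hypVol := by
  have : SigmaFinite (volume.withDensity fun v : EuclideanSpace ℝ (Fin 3) =>
      ENNReal.ofReal (1 / √(1 + ‖v‖ ^ 2))) :=
    SigmaFinite.withDensity_ofReal _
  exact hypEquiv.sigmaFinite_map

/-- The projector kernel `sin (ρ d) / (ρ sinh d)`, `d = d(x,y)`, extended by continuity to
`d = 0` (value `1`) and to `ρ = 0` (value `d / sinh d`). -/
def projKernel (ρ : ℝ) (x y : Hyp) : ℝ :=
  if hypDist x y = 0 then 1
  else if ρ = 0 then hypDist x y / Real.sinh (hypDist x y)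
  else Real.sin (ρ * hypDist x y) / (ρ * Real.sinh (hypDist x y))

/-- The integrand of the 4-simplex amplitude: one kernel for each of the ten edges `i < j` of the
complete graph on five vertices, evaluated at the points `y 0, …, y 3` and `x₅`. -/
def tenIntegrand (ρ : Sym2 (Fin 5) → ℝ) (x₅ : Hyp) (y : Fin 4 → Hyp) : ℝ :=
  let x : Fin 5 → Hyp := Fin.snoc y x₅
  ∏ p : Fin 5 × Fin 5 with p.1 < p.2, projKernel (ρ s(p.1, p.2)) (x p.1) (x p.2)

/-- The 4-simplex amplitude, regularized by not integrating over the fifth point `x₅`. -/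
def ampTen (ρ : Sym2 (Fin 5) → ℝ) (x₅ : Hyp) : ℝ :=
  1 / (2 * Real.pi ^ 2) *
    ∫ y : Fin 4 → Hyp, tenIntegrand ρ x₅ y ∂(Measure.pi fun _ => hypVol)

end

open MeasureTheory
open scoped ENNReal

local notation "ℝ³" => EuclideanSpace ℝ (Fin 3)

/-! Since `|sin (ρd)| ≤ min 1 (ρd)`, each kernel is at most `w (1 + d) / sinh d`, where `w` may be
taken as `1` or, if `ρ > 0`, as `1/ρ`, independently on each edge. All the bounds thus reduce to one
label-free fact: the product of the ten majorants has integral bounded uniformly in `x₅`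
(`exists_lintegral_prod_edgeWeight_le`).

For that, the complete graph is split into its five stars, each edge shared equally by its two
endpoints. Hölder with five exponents `1/5` leaves star integrals of `F ^ (5/2)`, which factor into
one-point integrals (`lintegral_prod_edges_le`). Boost invariance moves each of these to the origin
(`lintegral_minkowski_le`), where `5/2` lies strictly between the exponent `2` needed at infinity
and the exponent `3` allowed at the singularity. -/

/-! ### Hölder on the complete graph, via stars -/

/-- Every edge lies in exactly two stars and gets exponent `5/2 · 1/5 = 1/2` from each. -/
theorem prod_edges_eq_prod_stars {α : Type*} {F : α → α → ℝ≥0∞} (hsymm : ∀ x y, F x y = F y x)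
    (x : Fin 5 → α) :
    ∏ p : Fin 5 × Fin 5 with p.1 < p.2, F (x p.1) (x p.2) =
      ∏ i, (∏ j : Fin 4, F (x i) (x (i.succAbove j)) ^ (5 / 2 : ℝ)) ^ (1 / 5 : ℝ) := by
  have hroot : ∀ a : ℝ≥0∞, a = a ^ (1 / 2 : ℝ) * a ^ (1 / 2 : ℝ) := fun a => by
    rw [← ENNReal.rpow_add_of_nonneg _ _ (by norm_num) (by norm_num)]
    norm_num
  have hstar : ∀ i, (∏ j : Fin 4, F (x i) (x (i.succAbove j)) ^ (5 / 2 : ℝ)) ^ (1 / 5 : ℝ) =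
      ∏ j : Fin 4, F (x i) (x (i.succAbove j)) ^ (1 / 2 : ℝ) := fun i => by
    rw [← ENNReal.prod_rpow_of_nonneg (by norm_num)]
    refine Finset.prod_congr rfl fun j _ => ?_
    rw [← ENNReal.rpow_mul]
    norm_num
  have hprod : ∀ g : Fin 5 → Fin 5 → ℝ≥0∞, (∀ i j, g i j = g j i) →
      (∏ p : Fin 5 × Fin 5 with p.1 < p.2, g p.1 p.2) *
        (∏ p : Fin 5 × Fin 5 with p.1 < p.2, g p.1 p.2) = ∏ i, ∏ j : Fin 4, g i (i.succAbove j) := by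
    intro g hg
    have hs : (Finset.univ.filter fun p : Fin 5 × Fin 5 => p.1 < p.2) =
      {(0, 1), (0, 2), (0, 3), (0, 4), (1, 2), (1, 3), (1, 4), (2, 3), (2, 4), (3, 4)} := by decide
    have h2 : ∀ i, ∏ j : Fin 4, g i (i.succAbove j) = ∏ j ∈ Finset.univ.erase i, g i j := by
      intro i
      rw [← Finset.compl_singleton, ← Fin.image_succAbove_univ,
        Finset.prod_image (Fin.succAbove_right_injective.injOn)]
    have e : ∀ i : Fin 5, Finset.univ.erase i =
      ({i + 1, i + 2, i + 3, i + 4} : Finset (Fin 5)) := by decide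
    have e1 : ∀ i : Fin 5, i + 1 ∉ ({i + 2, i + 3, i + 4} : Finset (Fin 5)) := by decide
    have e2 : ∀ i : Fin 5, i + 2 ∉ ({i + 3, i + 4} : Finset (Fin 5)) := by decide
    have e3 : ∀ i : Fin 5, i + 3 ∉ ({i + 4} : Finset (Fin 5)) := by decide
    simp_rw [h2, e, Finset.prod_insert (e1 _), Finset.prod_insert (e2 _),
      Finset.prod_insert (e3 _), Finset.prod_singleton, hs]
    simp [Fin.prod_univ_five]
    rw [hg 1 0, hg 2 0, hg 3 0, hg 4 0, hg 2 1, hg 3 1, hg 4 1, hg 3 2, hg 4 2, hg 4 3]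
    ring
  simp_rw [hstar]
  rw [← hprod (fun i j => F (x i) (x j) ^ (1 / 2 : ℝ)) (fun i j => by rw [hsymm]),
    ← Finset.prod_mul_distrib]
  exact Finset.prod_congr rfl fun p _ => hroot _

section Star

variable {α : Type*} [MeasurableSpace α] {μ : Measure α} [SigmaFinite μ]

theorem lintegral_pi_prod_eq_pow (n : ℕ) {f : α → ℝ≥0∞} (hf : Measurable f) :
    ∫⁻ y : Fin n → α, ∏ k, f (y k) ∂(Measure.pi fun _ => μ) = (∫⁻ x, f x ∂μ) ^ n := by
  induction n with
  | zero => simp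
  | succ n ih =>
    have hm : Measurable fun y : Fin n → α => ∏ k, f (y k) := by fun_prop
    rw [← ((measurePreserving_piFinSuccAbove (fun _ : Fin (n + 1) => μ) 0).symm).lintegral_comp_emb
      (MeasurableEquiv.measurableEmbedding _)]
    simp_rw [MeasurableEquiv.piFinSuccAbove_symm_apply, Fin.insertNthEquiv, Equiv.coe_fn_mk,
      Fin.prod_univ_succAbove _ 0, Fin.insertNth_apply_same, Fin.insertNth_apply_succAbove]
    rw [lintegral_prod_mul hf.aemeasurable hm.aemeasurable, ih, pow_succ']

/-- A star with one marked vertex: the bound for integrating out the other vertices. -/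
theorem lintegral_star_le {F : α → α → ℝ≥0∞} (hF : Measurable fun p : α × α => F p.1 p.2)
    (hsymm : ∀ x y, F x y = F y x) {C : ℝ≥0∞} (hC : ∀ y, ∫⁻ x, F x y ∂μ ≤ C) {n : ℕ} (z : α)
    (i : Fin (n + 2)) :
    ∫⁻ y : Fin (n + 1) → α, ∏ j : Fin (n + 1),
      F ((Fin.snoc y z : Fin (n + 2) → α) i) ((Fin.snoc y z : Fin (n + 2) → α) (i.succAbove j))
        ∂(Measure.pi fun _ => μ) ≤ C ^ (n + 1) := by
  have hFx : ∀ x, Measurable (F x) := fun x => hF.comp (measurable_const.prodMk measurable_id)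
  have hFz : ∀ z, Measurable fun x => F x z := fun z =>
    hF.comp (measurable_id.prodMk measurable_const)
  have hC' : ∀ x, ∫⁻ y, F x y ∂μ ≤ C := fun x => by simpa only [hsymm x] using hC x
  refine Fin.lastCases ?_ (fun k => ?_) i
  · simp only [Fin.snoc_last, Fin.succAbove_last, Fin.snoc_castSucc]
    rw [lintegral_pi_prod_eq_pow (n + 1) (hFx z)]
    exact pow_le_pow_left' (hC' z) _
  · have hlast : k.castSucc.succAbove (Fin.last n) = Fin.last (n + 1) := by
      rw [Fin.succAbove_castSucc_of_le _ _ (Fin.le_last _), Fin.succ_last]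
    simp only [Fin.snoc_castSucc, Fin.prod_univ_castSucc (n := n),
      Fin.castSucc_succAbove_castSucc, hlast, Fin.snoc_last]
    -- The centre is a free point and `z` is a leaf: the `n` free leaves are integrated first, then
    -- the centre against `z`.
    rw [← ((measurePreserving_piFinSuccAbove (fun _ : Fin (n + 1) => μ) k).symm).lintegral_comp_emb
      (MeasurableEquiv.measurableEmbedding _)]
    simp_rw [MeasurableEquiv.piFinSuccAbove_symm_apply, Fin.insertNthEquiv, Equiv.coe_fn_mk,
      Fin.insertNth_apply_same, Fin.insertNth_apply_succAbove]
    refine (lintegral_prod_le _).trans ?_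
    calc ∫⁻ x, ∫⁻ y : Fin n → α, (∏ j, F x (y j)) * F x z ∂(Measure.pi fun _ => μ) ∂μ
        = ∫⁻ x, (∫⁻ y, F x y ∂μ) ^ n * F x z ∂μ := by
          refine lintegral_congr fun x => ?_
          rw [lintegral_mul_const _ (by have := hFx x; fun_prop), lintegral_pi_prod_eq_pow n (hFx x)]
      _ ≤ ∫⁻ x, C ^ n * F x z ∂μ := lintegral_mono fun x => by gcongr; exact hC' x
      _ ≤ C ^ n * C := by
          rw [lintegral_const_mul _ (hFz z)]
          gcongr
          exact hC z
      _ = C ^ (n + 1) := (pow_succ _ _).symm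

/-- The complete graph on five vertices with one vertex fixed converges as soon as its edge weight
is uniformly in `L^{5/2}`. -/
theorem lintegral_prod_edges_le {F : α → α → ℝ≥0∞} (hF : Measurable fun p : α × α => F p.1 p.2)
    (hsymm : ∀ x y, F x y = F y x) {C : ℝ≥0∞}
    (hC : ∀ y, ∫⁻ x, F x y ^ (5 / 2 : ℝ) ∂μ ≤ C) (z : α) :
    ∫⁻ y : Fin 4 → α, ∏ p : Fin 5 × Fin 5 with p.1 < p.2,
      F ((Fin.snoc y z : Fin 5 → α) p.1) ((Fin.snoc y z : Fin 5 → α) p.2)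
        ∂(Measure.pi fun _ => μ) ≤ C ^ 4 := by
  have hx : ∀ i, Measurable fun y : Fin 4 → α => (Fin.snoc y z : Fin 5 → α) i := by
    refine fun i => Fin.lastCases ?_ (fun k => ?_) i
    · simp only [Fin.snoc_last, measurable_const]
    · simpa only [Fin.snoc_castSucc] using measurable_pi_apply k
  have hm : ∀ i j, Measurable fun y : Fin 4 → α =>
      F ((Fin.snoc y z : Fin 5 → α) i) ((Fin.snoc y z : Fin 5 → α) j) := fun i j =>
    hF.comp ((hx i).prodMk (hx j))
  simp_rw [prod_edges_eq_prod_stars hsymm]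
  refine (ENNReal.lintegral_prod_norm_pow_le Finset.univ
    (f := fun i y => ∏ j : Fin 4, F ((Fin.snoc y z : Fin 5 → α) i)
      ((Fin.snoc y z : Fin 5 → α) (i.succAbove j)) ^ (5 / 2 : ℝ))
    (fun i _ => (Finset.measurable_prod _ fun j _ =>
      (hm _ _).pow_const _).aemeasurable) (by simp) (by simp)).trans ?_
  refine (Finset.prod_le_prod' (g := fun _ => (C ^ 4) ^ (1 / 5 : ℝ)) fun i _ => ?_).trans ?_
  · gcongr
    exact lintegral_star_le (F := fun x y => F x y ^ (5 / 2 : ℝ)) (hF.pow_const _)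
      (fun x y => by rw [hsymm]) hC z i
  · rw [Finset.prod_const, Finset.card_univ, Fintype.card_fin, ← ENNReal.rpow_natCast,
      ← ENNReal.rpow_mul]
    norm_num

end Star

/-! ### Minkowski product and invariance of the volume under boosts -/

theorem one_le_minkowski (x y : Hyp) : 1 ≤ minkowski x.1 y.1 := by
  obtain ⟨⟨t, v⟩, h1, h2⟩ := x
  obtain ⟨⟨s, w⟩, h3, h4⟩ := y
  simp only [minkowski, real_inner_self_eq_norm_sq] at h1 h2 h3 h4 ⊢
  have hin : inner ℝ v w ≤ ‖v‖ * ‖w‖ := real_inner_le_norm v w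
  have hst : 1 + ‖v‖ * ‖w‖ ≤ t * s := by
    refine (sq_le_sq₀ (by positivity) (by positivity)).1 ?_
    have : (t * s) ^ 2 = (1 + ‖v‖ ^ 2) * (1 + ‖w‖ ^ 2) := by
      rw [mul_pow, show t ^ 2 = 1 + ‖v‖ ^ 2 by linarith, show s ^ 2 = 1 + ‖w‖ ^ 2 by linarith]
    nlinarith [sq_nonneg (‖v‖ - ‖w‖)]
  linarith

theorem minkowski_comm (x y : ℝ × ℝ³) : minkowski x y = minkowski y x := by
  simp only [minkowski, real_inner_comm, mul_comm]

theorem measurable_minkowski :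
    Measurable fun p : Hyp × Hyp => minkowski p.1.1 p.2.1 := by
  unfold minkowski
  fun_prop

theorem lintegral_hypVol {f : Hyp → ℝ≥0∞} (hf : Measurable f) :
    ∫⁻ x, f x ∂hypVol =
      ∫⁻ v : ℝ³, ENNReal.ofReal (1 / √(1 + ‖v‖ ^ 2)) * f (hypPoint v) := by
  unfold hypVol
  rw [lintegral_map_equiv, lintegral_withDensity_eq_lintegral_mul _ (by fun_prop)
    (g := fun v => f (hypEquiv v)) (hf.comp hypEquiv.measurable)]
  rfl

section Boost

/-- The time component of the boost of rapidity `-arsinh s` along `n`. -/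
noncomputable def boostTime (c s : ℝ) (n v : ℝ³) : ℝ := c * √(1 + ‖v‖ ^ 2) - s * inner ℝ n v

/-- The spatial part of a boost along `n`, in the coordinate `v`. -/
noncomputable def boostSpace (c s : ℝ) (n v : ℝ³) : ℝ³ :=
  v + ((c - 1) * inner ℝ n v - s * √(1 + ‖v‖ ^ 2)) • n

variable {c s : ℝ} {n : ℝ³}

theorem inner_boostSpace (hn : ‖n‖ = 1) (v : ℝ³) :
    inner ℝ n (boostSpace c s n v) = c * inner ℝ n v - s * √(1 + ‖v‖ ^ 2) := by
  simp only [boostSpace, inner_add_right, inner_smul_right, real_inner_self_eq_norm_sq, hn]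
  ring

theorem one_add_norm_boostSpace_sq (hn : ‖n‖ = 1) (hcs : c ^ 2 - s ^ 2 = 1) (v : ℝ³) :
    1 + ‖boostSpace c s n v‖ ^ 2 = boostTime c s n v ^ 2 := by
  have hE : √(1 + ‖v‖ ^ 2) ^ 2 = 1 + ‖v‖ ^ 2 := Real.sq_sqrt (by positivity)
  rw [boostSpace, boostTime, norm_add_sq_real, norm_smul, hn, inner_smul_right,
    real_inner_comm n v, mul_one, Real.norm_eq_abs, sq_abs]
  generalize √(1 + ‖v‖ ^ 2) = E at *
  generalize inner ℝ n v = a at *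
  linear_combination (a ^ 2 - E ^ 2) * hcs - hE

theorem boostTime_pos (hn : ‖n‖ = 1) (hc : 0 < c) (hcs : c ^ 2 - s ^ 2 = 1) (v : ℝ³) :
    0 < boostTime c s n v := by
  have hE : √(1 + ‖v‖ ^ 2) ^ 2 = 1 + ‖v‖ ^ 2 := Real.sq_sqrt (by positivity)
  have ha : (inner ℝ n v) ^ 2 ≤ ‖v‖ ^ 2 := by
    rw [← sq_abs]
    gcongr
    simpa [hn] using abs_real_inner_le_norm n v
  have h : s * inner ℝ n v < c * √(1 + ‖v‖ ^ 2) := by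
    refine lt_of_pow_lt_pow_left₀ 2 (by positivity) ?_
    rw [mul_pow, mul_pow, hE]
    nlinarith [sq_nonneg s, sq_nonneg c]
  exact sub_pos.2 h

theorem sqrt_one_add_norm_boostSpace_sq (hn : ‖n‖ = 1) (hc : 0 < c) (hcs : c ^ 2 - s ^ 2 = 1)
    (v : ℝ³) : √(1 + ‖boostSpace c s n v‖ ^ 2) = boostTime c s n v := by
  rw [one_add_norm_boostSpace_sq hn hcs, Real.sqrt_sq (boostTime_pos hn hc hcs v).le]

theorem boostSpace_injective (hn : ‖n‖ = 1) (hc : 0 < c) (hcs : c ^ 2 - s ^ 2 = 1) :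
    Function.Injective (boostSpace c s n) := by
  intro v w h
  -- The inverse boost, with `s` replaced by `-s`, recovers `u` from its image.
  have hrec : ∀ u : ℝ³, u = boostSpace c s n u -
      (inner ℝ n (boostSpace c s n u) - (c * inner ℝ n (boostSpace c s n u) +
        s * √(1 + ‖boostSpace c s n u‖ ^ 2))) • n := by
    intro u
    rw [sqrt_one_add_norm_boostSpace_sq hn hc hcs, inner_boostSpace hn, boostTime, boostSpace,
      eq_sub_iff_add_eq, add_right_inj]
    congr 1
    linear_combination (-inner ℝ n u) * hcs
  rw [hrec v, hrec w, h]

theorem hasFDerivAt_boostSpace (v : ℝ³) :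
    HasFDerivAt (boostSpace c s n) (ContinuousLinearMap.id ℝ ℝ³ +
      ((c - 1) • innerSL ℝ n - (s / √(1 + ‖v‖ ^ 2)) • innerSL ℝ v).smulRight n) v := by
  have h0 : (1 + ‖v‖ ^ 2) ≠ 0 := by positivity
  have h1 : HasFDerivAt (fun v : ℝ³ => inner ℝ n v) (innerSL ℝ n) v := (innerSL ℝ n).hasFDerivAt
  have h2 : HasFDerivAt (fun v : ℝ³ => √(1 + ‖v‖ ^ 2))
      ((1 / (2 * √(1 + ‖v‖ ^ 2))) • (2 • innerSL ℝ v)) v :=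
    ((hasStrictFDerivAt_norm_sq v).hasFDerivAt.const_add 1).sqrt h0
  refine ((hasFDerivAt_id v).add (((h1.const_mul (c - 1)).sub (h2.const_mul s)).smul_const n)
    ).congr_fderiv ?_
  ext u : 1
  have : √(1 + ‖v‖ ^ 2) ≠ 0 := by positivity
  simp only [add_apply, ContinuousLinearMap.smulRight_apply,
    sub_apply, smul_apply, innerSL_apply_apply, smul_eq_mul,
    nsmul_eq_mul, Nat.cast_ofNat]
  congr 3
  field_simp

/-- The derivative is a rank-one perturbation of the identity, `id + f ⊗ n`, with determinant `1 + f
n`. The resulting ratio of energies is what makes `d³v / √(1 + |v|²)` invariant. -/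
theorem det_fderiv_boostSpace (hn : ‖n‖ = 1) (v : ℝ³) :
    (ContinuousLinearMap.id ℝ ℝ³ + ((c - 1) • innerSL ℝ n -
      (s / √(1 + ‖v‖ ^ 2)) • innerSL ℝ v).smulRight n).det =
        boostTime c s n v / √(1 + ‖v‖ ^ 2) := by
  have : √(1 + ‖v‖ ^ 2) ≠ 0 := by positivity
  have h := LinearMap.transvection.det
    (((c - 1) • innerSL ℝ n - (s / √(1 + ‖v‖ ^ 2)) • innerSL ℝ v : ℝ³ →L[ℝ] ℝ) : ℝ³ →ₗ[ℝ] ℝ) n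
  refine (Eq.trans ?_ h).trans ?_
  · rfl
  · simp only [ContinuousLinearMap.coe_coe, sub_apply,
      smul_apply, innerSL_apply_apply, real_inner_self_eq_norm_sq, hn,
      smul_eq_mul, boostTime, real_inner_comm v n]
    field_simp
    ring

end Boost

/-- An integral over hyperbolic space of a function of the distance to a point is largest,
up to equality, when centered at the origin. -/
theorem lintegral_minkowski_le {g : ℝ → ℝ≥0∞} (hg : Measurable g) (y : Hyp) :
    ∫⁻ x : Hyp, g (minkowski x.1 y.1) ∂hypVol ≤
      ∫⁻ v : ℝ³, ENNReal.ofReal (1 / √(1 + ‖v‖ ^ 2)) * g √(1 + ‖v‖ ^ 2) := by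
  obtain ⟨c, s, n, hn, hc, hcs, hy⟩ : ∃ (c s : ℝ) (n : ℝ³), ‖n‖ = 1 ∧ 0 < c ∧ c ^ 2 - s ^ 2 = 1 ∧
      y.1 = (c, s • n) := by
    obtain ⟨⟨t, w⟩, h1, h2⟩ := y
    simp only [minkowski, real_inner_self_eq_norm_sq] at h1 h2
    by_cases hw : w = 0
    · refine ⟨t, 0, EuclideanSpace.single 0 1, by simp, h2, ?_, by simp [hw]⟩
      simp only [hw, norm_zero] at h1
      linarith
    · refine ⟨t, ‖w‖, ‖w‖⁻¹ • w, by rw [norm_smul, norm_inv, norm_norm,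
        inv_mul_cancel₀ (norm_ne_zero_iff.2 hw)], h2, by linarith, ?_⟩
      rw [smul_smul, mul_inv_cancel₀ (norm_ne_zero_iff.2 hw), one_smul]
  rw [lintegral_hypVol (f := fun x => g (minkowski x.1 y.1)) (hg.comp (measurable_minkowski.comp
    (measurable_id.prodMk measurable_const)))]
  have hM : ∀ v, minkowski (hypPoint v).1 y.1 = boostTime c s n v := fun v => by
    rw [hy]
    simp only [minkowski, hypPoint, boostTime, inner_smul_right, real_inner_comm v n]
    ring
  calc ∫⁻ v : ℝ³, ENNReal.ofReal (1 / √(1 + ‖v‖ ^ 2)) * g (minkowski (hypPoint v).1 y.1)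
      = ∫⁻ v in Set.univ, ENNReal.ofReal |(ContinuousLinearMap.id ℝ ℝ³ + ((c - 1) • innerSL ℝ n -
          (s / √(1 + ‖v‖ ^ 2)) • innerSL ℝ v).smulRight n).det| *
          (ENNReal.ofReal (1 / √(1 + ‖boostSpace c s n v‖ ^ 2)) *
            g √(1 + ‖boostSpace c s n v‖ ^ 2)) := by
        rw [Measure.restrict_univ]
        refine lintegral_congr fun v => ?_
        have hpos := boostTime_pos hn hc hcs v
        rw [hM, det_fderiv_boostSpace hn, sqrt_one_add_norm_boostSpace_sq hn hc hcs,
          abs_of_pos (by positivity), ← mul_assoc, ← ENNReal.ofReal_mul (by positivity)]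
        congr 2
        field_simp
    _ = ∫⁻ v in boostSpace c s n '' Set.univ,
          ENNReal.ofReal (1 / √(1 + ‖v‖ ^ 2)) * g √(1 + ‖v‖ ^ 2) :=
        (lintegral_image_eq_lintegral_abs_det_fderiv_mul volume MeasurableSet.univ
          (fun v _ => (hasFDerivAt_boostSpace v).hasFDerivWithinAt)
          (boostSpace_injective hn hc hcs).injOn
          (fun v => ENNReal.ofReal (1 / √(1 + ‖v‖ ^ 2)) * g √(1 + ‖v‖ ^ 2))).symm
    -- An upper bound suffices, so surjectivity of the boost plays no role.
    _ ≤ _ := setLIntegral_le_lintegral _ _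

/-! ### The kernel majorant and its `L^{5/2}` bound -/

/-- A majorant of the projector kernel, as a function of `cosh d`. -/
noncomputable def edgeWeight (c : ℝ) : ℝ≥0∞ :=
  ENNReal.ofReal (10 * (2 * c) ^ (1 / 10 : ℝ)) / ENNReal.ofReal √(c ^ 2 - 1)

theorem measurable_edgeWeight : Measurable edgeWeight := by
  unfold edgeWeight
  fun_prop

/-- Uses `e^d ≤ 2 cosh d`. Any power below `1/5` would keep the `5/2`-th power of the majorant
integrable at infinity. -/
theorem one_add_arcosh_le {c : ℝ} (hc : 1 ≤ c) :
    1 + Real.arcosh c ≤ 10 * (2 * c) ^ (1 / 10 : ℝ) := by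
  have hd := Real.arcosh_nonneg hc
  have h1 : Real.exp (Real.arcosh c) ≤ 2 * c := by
    have h := Real.cosh_arcosh hc
    rw [Real.cosh_eq] at h
    linarith [Real.exp_pos (-Real.arcosh c)]
  calc 1 + Real.arcosh c ≤ 10 * Real.exp (Real.arcosh c * (1 / 10)) := by
        linarith [Real.add_one_le_exp (Real.arcosh c * (1 / 10))]
    _ = 10 * Real.exp (Real.arcosh c) ^ (1 / 10 : ℝ) := by rw [Real.exp_mul]
    _ ≤ _ := by gcongr

theorem enorm_projKernel_le {ρ w : ℝ} (hρ : 0 ≤ ρ) (hw : w = 1 ∨ 0 < ρ ∧ w = 1 / ρ) (x y : Hyp) :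
    ‖projKernel ρ x y‖ₑ ≤ ENNReal.ofReal w * edgeWeight (minkowski x.1 y.1) := by
  have hw0 : 0 < w := by
    rcases hw with rfl | ⟨h, rfl⟩
    · exact one_pos
    · positivity
  have hc := one_le_minkowski x y
  unfold projKernel hypDist
  generalize minkowski x.1 y.1 = c at *
  rw [edgeWeight]
  rcases hc.eq_or_lt with rfl | hlt
  -- At `d = 0` the majorant is a positive number over `0`, hence `∞`.
  · have h2 : (0 : ℝ) < 10 * (2 * 1) ^ (1 / 10 : ℝ) := by positivity
    rw [one_pow, sub_self, Real.sqrt_zero, ENNReal.ofReal_zero,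
      ENNReal.div_zero (ENNReal.ofReal_pos.2 h2).ne', ENNReal.mul_top (ENNReal.ofReal_pos.2 hw0).ne']
    exact le_top
  · have hd := Real.arcosh_pos hlt
    have hle := one_add_arcosh_le hc
    have hS : 0 < √(c ^ 2 - 1) := Real.sqrt_pos.2 (by nlinarith)
    rw [Real.sinh_arcosh hc, if_neg hd.ne', ← ENNReal.ofReal_div_of_pos hS,
      ← ENNReal.ofReal_mul hw0.le, Real.enorm_eq_ofReal_abs]
    apply ENNReal.ofReal_le_ofReal
    generalize Real.arcosh c = d at *
    generalize √(c ^ 2 - 1) = S at *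
    generalize 10 * (2 * c) ^ (1 / 10 : ℝ) = B at *
    rw [mul_div_assoc']
    split_ifs with h0
    · rcases hw with rfl | ⟨h, -⟩
      · rw [abs_of_pos (by positivity)]
        gcongr
        linarith
      · exact absurd h0 h.ne'
    · have hρ' : 0 < ρ := lt_of_le_of_ne hρ (Ne.symm h0)
      rw [← div_div, abs_div, abs_div, abs_of_pos hS, abs_of_pos hρ']
      gcongr
      rw [div_le_iff₀ hρ']
      rcases hw with rfl | ⟨-, rfl⟩
      · have h := Real.abs_sin_le_abs (x := ρ * d)
        rw [abs_of_pos (show 0 < ρ * d by positivity)] at h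
        nlinarith
      · rw [one_div_mul_eq_div, div_mul_cancel₀ _ hρ'.ne']
        linarith [Real.abs_sin_le_one (ρ * d)]

theorem lintegral_edgeWeight_base_lt_top :
    ∫⁻ v : ℝ³, ENNReal.ofReal (1 / √(1 + ‖v‖ ^ 2)) *
      edgeWeight √(1 + ‖v‖ ^ 2) ^ (5 / 2 : ℝ) < ∞ := by
  set f : ℝ → ℝ := fun r =>
    1 / √(1 + r ^ 2) * (10 * (2 * √(1 + r ^ 2)) ^ (1 / 10 : ℝ) / r) ^ (5 / 2 : ℝ) with hf
  set D : ℝ := 10 ^ (5 / 2 : ℝ) * 2 ^ (1 / 4 : ℝ) with hD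
  -- The radial density behaves like `r ^ (-1/2)` at `0` and `r ^ (-5/4)` at infinity, both
  -- integrable.
  have hfr : ∀ r : ℝ, 0 < r → r ^ 2 * f r = D * (√(1 + r ^ 2) ^ (-(3 / 4) : ℝ) *
      r ^ (-(1 / 2) : ℝ)) := by
    intro r hr
    have hE : 0 < √(1 + r ^ 2) := by positivity
    have h1 : √(1 + r ^ 2) ^ (-(3 / 4) : ℝ) = √(1 + r ^ 2) ^ (1 / 4 : ℝ) / √(1 + r ^ 2) := by
      rw [show (-(3 / 4) : ℝ) = 1 / 4 - 1 by norm_num, Real.rpow_sub_one hE.ne']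
    have h2 : r ^ (-(1 / 2) : ℝ) = r ^ 2 / r ^ (5 / 2 : ℝ) := by
      rw [show (-(1 / 2) : ℝ) = (2 : ℕ) - 5 / 2 by norm_num, Real.rpow_sub hr, Real.rpow_natCast]
    have h3 : (10 * (2 * √(1 + r ^ 2)) ^ (1 / 10 : ℝ) / r) ^ (5 / 2 : ℝ) =
        D * √(1 + r ^ 2) ^ (1 / 4 : ℝ) / r ^ (5 / 2 : ℝ) := by
      rw [Real.div_rpow (by positivity) hr.le, Real.mul_rpow (by norm_num) (by positivity),
        ← Real.rpow_mul (by positivity), Real.mul_rpow (by norm_num) hE.le, hD]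
      norm_num
      ring
    simp only [hf]
    rw [h1, h2, h3]
    ring
  have hD0 : 0 < D := by positivity
  have hmeas : Measurable fun r : ℝ => r ^ 2 * f r := by fun_prop
  have hE1 : ∀ r : ℝ, 1 ≤ √(1 + r ^ 2) := fun r => Real.one_le_sqrt.2 (by nlinarith [sq_nonneg r])
  have hint : IntegrableOn (fun r : ℝ => r ^ 2 * f r) (Set.Ioi 0) := by
    rw [← Set.Ioc_union_Ioi_eq_Ioi zero_le_one]
    refine IntegrableOn.union ?_ ?_
    · have h := (intervalIntegral.intervalIntegrable_rpow' (a := 0) (b := 1)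
        (r := -(1 / 2)) (by norm_num)).1
      refine (h.const_mul D).mono' hmeas.aestronglyMeasurable ?_
      refine ae_restrict_of_forall_mem measurableSet_Ioc fun r hr => ?_
      have hr0 : 0 < r := hr.1
      rw [hfr r hr0, Real.norm_of_nonneg (by positivity)]
      gcongr
      exact mul_le_of_le_one_left (by positivity)
        (Real.rpow_le_one_of_one_le_of_nonpos (hE1 r) (by norm_num))
    · have h := integrableOn_Ioi_rpow_of_lt (a := -(5 / 4)) (c := 1) (by norm_num) one_pos
      refine (h.const_mul D).mono' hmeas.aestronglyMeasurable ?_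
      refine ae_restrict_of_forall_mem measurableSet_Ioi fun r hr => ?_
      have hr0 : 0 < r := one_pos.trans hr
      rw [hfr r hr0, Real.norm_of_nonneg (by positivity),
        show (-(5 / 4) : ℝ) = -(3 / 4) + -(1 / 2) by norm_num, Real.rpow_add hr0]
      have hEr : r ≤ √(1 + r ^ 2) := Real.le_sqrt_of_sq_le (by linarith)
      exact mul_le_mul_of_nonneg_left (mul_le_mul_of_nonneg_right
        (Real.rpow_le_rpow_of_nonpos hr0 hEr (by norm_num)) (by positivity)) hD0.le
  have hint3 : Integrable (fun v : ℝ³ => f ‖v‖) := by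
    rw [integrable_fun_norm_addHaar volume (f := f)]
    simpa using hint
  refine lt_of_eq_of_lt (lintegral_congr_ae ?_) hint3.lintegral_lt_top
  -- At the origin the majorant is `∞` while real division gives `f 0 = 0`.
  have hne : ∀ᵐ v : ℝ³, v ≠ 0 := by
    simp [ae_iff, measure_singleton]
  filter_upwards [hne] with v hv
  have hv0 : 0 < ‖v‖ := norm_pos_iff.2 hv
  have hE : √(1 + ‖v‖ ^ 2) ^ 2 - 1 = ‖v‖ ^ 2 := by
    rw [Real.sq_sqrt (by positivity)]
    ring
  rw [edgeWeight, hE, Real.sqrt_sq hv0.le, ← ENNReal.ofReal_div_of_pos hv0,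
    ENNReal.ofReal_rpow_of_nonneg (by positivity) (by norm_num),
    ← ENNReal.ofReal_mul (by positivity)]

/-- The sum over all configurations of the product of the edge majorants is bounded uniformly. -/
theorem exists_lintegral_prod_edgeWeight_le : ∃ A : ℝ≥0∞, A < ∞ ∧ ∀ x₅ : Hyp,
    ∫⁻ y : Fin 4 → Hyp, ∏ p : Fin 5 × Fin 5 with p.1 < p.2,
      edgeWeight (minkowski ((Fin.snoc y x₅ : Fin 5 → Hyp) p.1).1
        ((Fin.snoc y x₅ : Fin 5 → Hyp) p.2).1) ∂(Measure.pi fun _ => hypVol) ≤ A :=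
  ⟨_, ENNReal.pow_lt_top lintegral_edgeWeight_base_lt_top, fun x₅ =>
    lintegral_prod_edges_le (F := fun x y : Hyp => edgeWeight (minkowski x.1 y.1))
      (measurable_edgeWeight.comp measurable_minkowski) (fun x y => by rw [minkowski_comm])
      (fun y => lintegral_minkowski_le (measurable_edgeWeight.pow_const _) y) x₅⟩

/-! ### Bounds on the amplitude -/

theorem measurable_projKernel (ρ : ℝ) :
    Measurable fun p : Hyp × Hyp => projKernel ρ p.1 p.2 := by
  have hd : Measurable fun p : Hyp × Hyp => hypDist p.1 p.2 := by
    have := measurable_minkowski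
    unfold hypDist Real.arcosh
    fun_prop
  unfold projKernel
  refine Measurable.ite (measurableSet_eq_fun hd measurable_const) measurable_const ?_
  split_ifs
  · fun_prop
  · fun_prop

theorem measurable_tenIntegrand (ρ : Sym2 (Fin 5) → ℝ) (x₅ : Hyp) :
    Measurable (tenIntegrand ρ x₅) := by
  have hx : ∀ i, Measurable fun y : Fin 4 → Hyp => (Fin.snoc y x₅ : Fin 5 → Hyp) i := by
    refine fun i => Fin.lastCases ?_ (fun k => ?_) i
    · simp only [Fin.snoc_last, measurable_const]
    · simpa only [Fin.snoc_castSucc] using measurable_pi_apply k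
  unfold tenIntegrand
  exact Finset.measurable_prod _ fun p _ =>
    (measurable_projKernel _).comp ((hx p.1).prodMk (hx p.2))

theorem lintegral_enorm_tenIntegrand_le {ρ w : Sym2 (Fin 5) → ℝ}
    (hρ : ∀ i j : Fin 5, i ≠ j → 0 ≤ ρ s(i, j))
    (hw : ∀ e, w e = 1 ∨ 0 < ρ e ∧ w e = 1 / ρ e) (x₅ : Hyp) {A : ℝ≥0∞}
    (hA : ∫⁻ y : Fin 4 → Hyp, ∏ p : Fin 5 × Fin 5 with p.1 < p.2,
      edgeWeight (minkowski ((Fin.snoc y x₅ : Fin 5 → Hyp) p.1).1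
        ((Fin.snoc y x₅ : Fin 5 → Hyp) p.2).1) ∂(Measure.pi fun _ => hypVol) ≤ A) :
    ∫⁻ y, ‖tenIntegrand ρ x₅ y‖ₑ ∂(Measure.pi fun _ => hypVol) ≤
      ENNReal.ofReal (∏ p : Fin 5 × Fin 5 with p.1 < p.2, w s(p.1, p.2)) * A := by
  have hw0 : ∀ e, 0 ≤ w e := fun e => by
    rcases hw e with h | ⟨h, h'⟩
    · exact h ▸ zero_le_one
    · rw [h']
      positivity
  refine le_trans ?_ (mul_le_mul_right hA _)
  rw [← lintegral_const_mul' _ _ ENNReal.ofReal_ne_top]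
  refine lintegral_mono fun y => ?_
  rw [ENNReal.ofReal_prod_of_nonneg fun p _ => hw0 _, ← Finset.prod_mul_distrib, tenIntegrand]
  rw [Real.enorm_eq_ofReal_abs, Finset.abs_prod,
    ENNReal.ofReal_prod_of_nonneg fun _ _ => abs_nonneg _]
  refine Finset.prod_le_prod' fun p hp => ?_
  rw [← Real.enorm_eq_ofReal_abs]
  exact enorm_projKernel_le (hρ _ _ (Finset.mem_filter.1 hp).2.ne) (hw _) _ _

theorem abs_ampTen_le {ρ w : Sym2 (Fin 5) → ℝ}
    (hρ : ∀ i j : Fin 5, i ≠ j → 0 ≤ ρ s(i, j))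
    (hw : ∀ e, w e = 1 ∨ 0 < ρ e ∧ w e = 1 / ρ e) (x₅ : Hyp) {A : ℝ≥0∞} (hAtop : A < ∞)
    (hA : ∫⁻ y : Fin 4 → Hyp, ∏ p : Fin 5 × Fin 5 with p.1 < p.2,
      edgeWeight (minkowski ((Fin.snoc y x₅ : Fin 5 → Hyp) p.1).1
        ((Fin.snoc y x₅ : Fin 5 → Hyp) p.2).1) ∂(Measure.pi fun _ => hypVol) ≤ A) :
    |ampTen ρ x₅| ≤ 1 / (2 * Real.pi ^ 2) * A.toReal *
      ∏ p : Fin 5 × Fin 5 with p.1 < p.2, w s(p.1, p.2) := by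
  have hw0 : ∀ e, 0 ≤ w e := fun e => by
    rcases hw e with h | ⟨h, h'⟩
    · exact h ▸ zero_le_one
    · rw [h']
      positivity
  have h := lintegral_enorm_tenIntegrand_le hρ hw x₅ hA
  rw [ampTen, abs_mul, abs_of_pos (by positivity), mul_assoc, mul_comm A.toReal]
  gcongr
  have h2 := (enorm_integral_le_lintegral_enorm (μ := Measure.pi fun _ => hypVol)
    (tenIntegrand ρ x₅)).trans h
  have h3 := ENNReal.toReal_mono (ENNReal.mul_ne_top ENNReal.ofReal_ne_top hAtop.ne) h2
  rwa [ENNReal.toReal_mul, ENNReal.toReal_ofReal (Finset.prod_nonneg fun _ _ => hw0 _),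
    toReal_enorm] at h3

theorem prod_edges_ite_eq {i j : Fin 5} (hij : i ≠ j) (a : ℝ) :
    (∏ p : Fin 5 × Fin 5 with p.1 < p.2, if s(p.1, p.2) = s(i, j) then a else 1) = a := by
  rw [Finset.prod_ite, Finset.prod_const_one, mul_one, Finset.prod_const, Finset.filter_filter]
  have : ∀ i j : Fin 5, i ≠ j → (Finset.univ.filter fun p : Fin 5 × Fin 5 =>
    p.1 < p.2 ∧ s(p.1, p.2) = s(i, j)).card = 1 := by decide
  rw [this i j hij, pow_one]

theorem mainTheorem6 :
    ∃ K K₁ K₂ : ℝ, ∀ ρ : Sym2 (Fin 5) → ℝ, (∀ i j : Fin 5, i ≠ j → 0 ≤ ρ s(i, j)) →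
      ∀ x₅ : Hyp,
        Integrable (tenIntegrand ρ x₅) (Measure.pi fun _ => hypVol) ∧
        (∀ i j k : Fin 5, i ≠ j → i ≠ k → j ≠ k →
          0 < ρ s(i, j) → 0 < ρ s(i, k) → 0 < ρ s(j, k) →
            |ampTen ρ x₅| ≤ K / (ρ s(i, j) * ρ s(i, k) * ρ s(j, k))) ∧
        (∀ i j k : Fin 5, i ≠ j → i ≠ k → j ≠ k →
          0 < ρ s(i, j) → 0 < ρ s(i, k) →
            |ampTen ρ x₅| ≤ K₁ / (ρ s(i, j) * ρ s(i, k))) ∧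
        (∀ i j : Fin 5, i ≠ j → 0 < ρ s(i, j) →
            |ampTen ρ x₅| ≤ K₂ / ρ s(i, j)) := by
  obtain ⟨A, hAtop, hA⟩ := exists_lintegral_prod_edgeWeight_le
  -- One constant serves all three bounds; only the set of edges with `w = 1/ρ` changes.
  refine ⟨1 / (2 * Real.pi ^ 2) * A.toReal, 1 / (2 * Real.pi ^ 2) * A.toReal,
    1 / (2 * Real.pi ^ 2) * A.toReal, fun ρ hρ x₅ => ⟨?_, ?_, ?_, ?_⟩⟩
  · refine ⟨(measurable_tenIntegrand ρ x₅).aestronglyMeasurable, ?_⟩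
    refine (lintegral_enorm_tenIntegrand_le (w := fun _ => 1) hρ (fun _ => Or.inl rfl) x₅
      (hA x₅)).trans_lt ?_
    exact ENNReal.mul_lt_top ENNReal.ofReal_lt_top hAtop
  · intro i j k hij hik hjk h1 h2 h3
    have hne : s(i, j) ≠ s(i, k) ∧ s(i, j) ≠ s(j, k) ∧ s(i, k) ≠ s(j, k) := by
      simp only [ne_eq, Sym2.eq_iff]
      tauto
    refine (abs_ampTen_le (w := fun e => (if e = s(i, j) then 1 / ρ s(i, j) else 1) *
      (if e = s(i, k) then 1 / ρ s(i, k) else 1) * (if e = s(j, k) then 1 / ρ s(j, k) else 1))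
      hρ (fun e => ?_) x₅ hAtop (hA x₅)).trans_eq ?_
    · by_cases e1 : e = s(i, j)
      · subst e1
        exact Or.inr ⟨h1, by simp [hne]⟩
      by_cases e2 : e = s(i, k)
      · subst e2
        exact Or.inr ⟨h2, by simp [hne, hne.1.symm]⟩
      by_cases e3 : e = s(j, k)
      · subst e3
        exact Or.inr ⟨h3, by simp [hne.2.1.symm, hne.2.2.symm]⟩
      exact Or.inl (by simp [e1, e2, e3])
    · simp only [Finset.prod_mul_distrib, prod_edges_ite_eq hij, prod_edges_ite_eq hik,
        prod_edges_ite_eq hjk]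
      field_simp
  · intro i j k hij hik hjk h1 h2
    have hne : s(i, j) ≠ s(i, k) := by
      simp only [ne_eq, Sym2.eq_iff]
      tauto
    refine (abs_ampTen_le (w := fun e => (if e = s(i, j) then 1 / ρ s(i, j) else 1) *
      (if e = s(i, k) then 1 / ρ s(i, k) else 1))
      hρ (fun e => ?_) x₅ hAtop (hA x₅)).trans_eq ?_
    · by_cases e1 : e = s(i, j)
      · subst e1
        exact Or.inr ⟨h1, by simp [hne]⟩
      by_cases e2 : e = s(i, k)
      · subst e2
        exact Or.inr ⟨h2, by simp [hne.symm]⟩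
      exact Or.inl (by simp [e1, e2])
    · simp only [Finset.prod_mul_distrib, prod_edges_ite_eq hij, prod_edges_ite_eq hik]
      field_simp
  · intro i j hij h1
    refine (abs_ampTen_le (w := fun e => if e = s(i, j) then 1 / ρ s(i, j) else 1)
      hρ (fun e => ?_) x₅ hAtop (hA x₅)).trans_eq ?_
    · by_cases e1 : e = s(i, j)
      · subst e1
        exact Or.inr ⟨h1, by simp⟩
      exact Or.inl (by simp [e1])
    · rw [prod_edges_ite_eq hij, mul_one_div]
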